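/- The Laplacian matrix $L=(\ell_{ij})$ of a digraph with vertex set $\{1,\dots,n\}$ has $\ell_{ij}=-1$ if $j\ne i$ and $(i,j)$ is an arc, $\ell_{ij}=0$ if $j\neq i$ and $(i,j)$ is not an arc, and $\ell_{ii}=-\sum_{j\ne i}\ell_{ij}$. A digraph is *essentially cyclic* if its Laplacian matrix has a non-real eigenvalue. For $m\ge 1$ let $Z_m(\lambda)=\det(\lambda I-M_m)$, where $M_m$ is the $m\times m$ tridiagonal matrix with diagonal $(2,\dots,2,1)$ and all entries on the two adjacent diagonals equal to $-1$ (so $M_1=(1)$). Let $C=\{(1,n),(n,n-1),\dots,(2,1)\}$ and $C^{-1}=\{(1,2),(2,3),\dots,(n-1,n),(n,1)\}$ be the two opposite Hamiltonian cycles on $\{1,\dots,n\}$. **Theorem 4.** Let $n>3$, and let $\Gamma_n$ be the digraph on $\{1,\dots,n\}$ whose arcs are those of $C$ and those of $C^{-1}$ except for $i$ arbitrary arcs of $C^{-1}$, where $2<i<n$. Then: 1. The characteristic polynomial of the Laplacian matrix $L_n$ of $\Gamma_n$ is $$\Delta_{L_n}(\lambda)=\prod_{k=1}^{K} Z_{i_k}(\lambda)-(-1)^n,$$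 where $i_1,\dots,i_K$ are the lengths of the paths into which the cycle $C$ is decomposed by the vertices of indegree $1$ in $\Gamma_n$ (each path links a vertex of indegree $1$ to the next one along $C$). 2. $\Gamma_n$ is essentially cyclic. Moreover, for $n\ge 3$, say that a digraph on $\{1,\dots,n\}$ has *ring structure* if it is isomorphic to a digraph whose arc set $E$ satisfies $C\subseteq E\subseteq C\cup C^{-1}$. Then a digraph with ring structure is essentially cyclic if and only if it is isomorphic to none of the following three digraphs: the one with arc set $C\cup C^{-1}$; the one with arc set $(C\cup C^{-1})\setminus\{(n,1)\}$; and the one with arc set $(C\cup C^{-1})\setminus\{(n,1),(\lfloor n/2\rfloor,\lfloor n/2\rfloor+1)\}$. -/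

import Mathlib

open Polynomial

namespace RingDigraph

section General

variable {V : Type*} [Fintype V] [DecidableEq V]

open Classical in
/-- The Laplacian matrix of a digraph: for `j ≠ i` the entry `(i, j)` is `-1` if `(i, j)` is an arc
and `0` otherwise, and the diagonal entries make all row sums vanish. -/
noncomputable def laplacian (Γ : Digraph V) : Matrix V V ℝ :=
  Matrix.of fun i j =>
    if i = j then -∑ k ∈ Finset.univ.erase i, (if Γ.Adj i k then (-1 : ℝ) else 0)
    else if Γ.Adj i j then -1 else 0

/-- A digraph is essentially cyclic if its Laplacian matrix has a non-real eigenvalue. -/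
def EssentiallyCyclic (Γ : Digraph V) : Prop :=
  ∃ μ ∈ spectrum ℂ ((laplacian Γ).map (algebraMap ℝ ℂ)), μ.im ≠ 0

end General

/-- The number of arcs of `Γ` that enter `v`. -/
noncomputable def indegree {V : Type*} (Γ : Digraph V) (v : V) : ℕ :=
  {u : V | Γ.Adj u v}.ncard

/-- Two digraphs are isomorphic if some bijection of the vertices preserves and reflects arcs. -/
def Isomorphic {V W : Type*} (Γ : Digraph V) (Δ : Digraph W) : Prop :=
  Nonempty (Γ.Adj ≃r Δ.Adj)

/-- The tridiagonal `n × n` matrix with `2` on the main diagonal, except for the last diagonal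
entry, which is `1`, and with `-1` on the two adjacent diagonals. -/
def M (n : ℕ) : Matrix (Fin n) (Fin n) ℝ :=
  Matrix.of fun i j =>
    if i = j then (if (i : ℕ) + 1 = n then 1 else 2)
    else if (i : ℕ) + 1 = j ∨ (j : ℕ) + 1 = i then -1 else 0

/-- The characteristic polynomial of `M n`; in particular `Z 0 = 1`. -/
noncomputable def Z (n : ℕ) : ℝ[X] := (M n).charpoly

/-! The vertices `1, …, n` are represented by their residues modulo `n`, so that `n` is `0`. -/

/-- The Hamiltonian cycle `(1, n), (n, n - 1), …, (2, 1)`. -/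
def hamCycle (n : ℕ) : Digraph (ZMod n) where
  Adj v w := w = v - 1

/-- The opposite cycle `(1, 2), (2, 3), …, (n - 1, n), (n, 1)`. -/
def oppCycle (n : ℕ) : Digraph (ZMod n) where
  Adj v w := w = v + 1

/-- `Γ` consists of the Hamiltonian cycle and of some arcs of the opposite cycle. -/
def IsRing {n : ℕ} (Γ : Digraph (ZMod n)) : Prop :=
  hamCycle n ≤ Γ ∧ Γ ≤ hamCycle n ⊔ oppCycle n

/-- `Γ` is a digraph with ring structure: up to isomorphism, it consists of the Hamiltonian cycle
and of some arcs of the opposite cycle. -/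
def HasRingStructure {n : ℕ} (Γ : Digraph (ZMod n)) : Prop :=
  ∃ Δ : Digraph (ZMod n), IsRing Δ ∧ Isomorphic Γ Δ

/-- The arcs of the opposite cycle that are missing in `Γ`. -/
def missingArcs {n : ℕ} (Γ : Digraph (ZMod n)) : Set (ZMod n × ZMod n) :=
  {a | (oppCycle n).Adj a.1 a.2 ∧ ¬ Γ.Adj a.1 a.2}

/-- The length of the path along the Hamiltonian cycle `v, v - 1, v - 2, …` from `v` to the next
vertex of indegree 1 (which is `v` itself, after a full turn, if there is no other one). -/
noncomputable def pathLength {n : ℕ} (Γ : Digraph (ZMod n)) (v : ZMod n) : ℕ :=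
  sInf {d : ℕ | 0 < d ∧ indegree Γ (v - (d : ZMod n)) = 1}

/-- The union of the two opposite Hamiltonian cycles. -/
def fullRing (n : ℕ) : Digraph (ZMod n) := hamCycle n ⊔ oppCycle n

/-- The two opposite Hamiltonian cycles without the arc `(n, 1)`. -/
def ringMinusOne (n : ℕ) : Digraph (ZMod n) where
  Adj v w := (hamCycle n).Adj v w ∨ ((oppCycle n).Adj v w ∧ v ≠ 0)

/-- The two opposite Hamiltonian cycles without the arcs `(n, 1)` and `(i, i + 1)`. -/
def ringMinusTwo (n i : ℕ) : Digraph (ZMod n) where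
  Adj v w := (hamCycle n).Adj v w ∨ ((oppCycle n).Adj v w ∧ v ≠ 0 ∧ v ≠ (i : ZMod n))

end RingDigraph

/-! Number the vertices upwards from a vertex `r` of indegree 1. Then `X - L` is tridiagonal except
for a corner entry 1 coming from the arc `(r, r - 1)`; the opposite corner is empty because `(r - 1,
r)` is missing. The corner contributes `-(-1) ^ n` (`det_tridiag_add_corner`). Each missing arc is a
zero on the superdiagonal, which splits the determinant (`det_tridiag_add`) into blocks equal to `Z`
of the path lengths. This gives `IsRing.charpoly_laplacian`.

Non-real roots: under `λ = 4 sin² s`, `Z m` becomes `(-1) ^ m * cos ((2m + 1) s) / cos s`. If `f`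
has three roots in an interval on which it never equals `c`, then `f - c` does not split: by Rolle,
`f'` would have too many zeros (`not_splits_sub_C`). With three or more blocks, or two blocks whose
lengths differ by at least 2, such an interval `(0, 4 sin² s₀]` exists (`not_splits_prod_Z_sub_C`,
`not_splits_Z_mul_Z_sub_C`).

Real roots: the full ring has a symmetric Laplacian. For one block, or two blocks of lengths
differing by at most 1, the equation in `s` factors into sines of integer multiples of `s`, so every
complex solution `s` is real. Up to rotation these are exactly the three exceptional digraphs. -/

namespace RingDigraph

/-! ### Determinants of tridiagonal matrices, with and without a corner entry -/

section Tridiagonal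

variable {R : Type*} [CommRing R]

/-- The tridiagonal matrix with diagonal `d`, superdiagonal `c`, and ones on the subdiagonal. -/
def tridiag (d c : ℕ → R) (m : ℕ) : Matrix (Fin m) (Fin m) R :=
  Matrix.of fun i j => if (i : ℕ) = j then d i else if (i : ℕ) + 1 = j then c i
    else if (j : ℕ) + 1 = i then 1 else 0

/-- The only entry that can be nonzero in the upper right block is `c (p - 1)`, so the matrix is
block lower triangular. Writing the hypothesis with `p'` makes it vacuous for `p = 0`. -/
theorem det_tridiag_add (d c : ℕ → R) (p q : ℕ) (h : ∀ p', p' + 1 = p → c p' = 0) :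
    (tridiag d c (p + q)).det =
      (tridiag d c p).det * (tridiag (fun i => d (p + i)) (fun i => c (p + i)) q).det := by
  rw [← Matrix.det_submatrix_equiv_self (finSumFinEquiv (m := p) (n := q)),
    ← Matrix.det_fromBlocks_zero₁₂ _
      (Matrix.of fun (i : Fin q) (j : Fin p) => if (j : ℕ) + 1 = p + i then (1 : R) else 0)]
  congr 1
  ext i j
  rcases i with i | i <;> rcases j with j | j <;>
    simp only [tridiag, Matrix.submatrix_apply, Matrix.of_apply, finSumFinEquiv_apply_left,
      finSumFinEquiv_apply_right, Matrix.fromBlocks_apply₁₁, Matrix.fromBlocks_apply₁₂,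
      Matrix.fromBlocks_apply₂₁, Matrix.fromBlocks_apply₂₂, Fin.val_castAdd, Fin.val_natAdd,
      Matrix.zero_apply]
  · have := i.2
    split_ifs with h1 h2 h3
    · omega
    · exact h _ (by omega)
    · omega
    · rfl
  · have := j.2
    rw [if_neg (by omega), if_neg (by omega)]
  · simp only [add_assoc, Nat.add_left_cancel_iff]

theorem det_tridiag_succ_succ (d c : ℕ → R) (m : ℕ) :
    (tridiag d c (m + 2)).det =
      d 0 * (tridiag (fun i => d (i + 1)) (fun i => c (i + 1)) (m + 1)).det -
        c 0 * (tridiag (fun i => d (i + 2)) (fun i => c (i + 2)) m).det := by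
  rw [Matrix.det_succ_row_zero, Fin.sum_univ_succ, Fin.sum_univ_succ]
  rw [Finset.sum_eq_zero (fun i _ => by simp [tridiag])]
  have h1 : (tridiag d c (m + 2)).submatrix Fin.succ (Fin.succAbove 0) =
      tridiag (fun i => d (i + 1)) (fun i => c (i + 1)) (m + 1) := by
    ext i j
    simp [tridiag]
  have h2 : ((tridiag d c (m + 2)).submatrix Fin.succ (Fin.succAbove (Fin.succ 0))).det =
      (tridiag (fun i => d (i + 2)) (fun i => c (i + 2)) m).det := by
    rw [Matrix.det_succ_column_zero, Fin.sum_univ_succ, Finset.sum_eq_zero (fun i _ => by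
      simp [tridiag])]
    have : (((tridiag d c (m + 2)).submatrix Fin.succ (Fin.succAbove (Fin.succ 0))).submatrix
        (Fin.succAbove 0) Fin.succ) = tridiag (fun i => d (i + 2)) (fun i => c (i + 2)) m := by
      ext i j
      simp [tridiag, Fin.succAbove]
    rw [this]
    simp [tridiag, Fin.succAbove]
  rw [h1, h2]
  simp [tridiag]
  ring

/-- By linearity in row 0, the corner adds its own cofactor. The minor that remains is upper
triangular, with the ones of the old subdiagonal on its diagonal. -/
theorem det_tridiag_add_corner (d c : ℕ → R) (k : ℕ) (A : Matrix (Fin (k + 2)) (Fin (k + 2)) R)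
    (hA : ∀ i j, A i j = tridiag d c (k + 2) i j + if i = 0 ∧ j = Fin.last _ then 1 else 0) :
    A.det = (tridiag d c (k + 2)).det - (-1) ^ (k + 2) := by
  have hA' : A = (tridiag d c (k + 2)).updateRow 0
      (tridiag d c (k + 2) 0 + Pi.single (Fin.last _) 1) := by
    ext i j
    rw [hA]
    rcases eq_or_ne i 0 with rfl | hi
    · simp [Pi.single_apply]
    · simp [hi]
  have hdet : ((tridiag d c (k + 2)).submatrix (Fin.succAbove 0)
      (Fin.succAbove (Fin.last (k + 1)))).det = 1 := by
    rw [Matrix.det_of_isUpperTriangular, Finset.prod_eq_one]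
    · intro i _
      simp only [tridiag, Matrix.submatrix_apply, Matrix.of_apply, Fin.succAbove_zero,
        Fin.succAbove_last, Fin.val_succ, Fin.val_castSucc]
      rw [if_neg (by omega), if_neg (by omega), if_pos trivial]
    · intro i j hij
      have : (j : ℕ) < i := hij
      simp only [tridiag, Matrix.submatrix_apply, Matrix.of_apply, Fin.succAbove_zero,
        Fin.succAbove_last, Fin.val_succ, Fin.val_castSucc]
      rw [if_neg (by omega), if_neg (by omega), if_neg (by omega)]
  rw [hA', Matrix.det_updateRow_add, Matrix.updateRow_eq_self, ← Matrix.adjugate_apply,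
    Matrix.adjugate_fin_succ_eq_det_submatrix, hdet]
  simp only [Fin.val_zero, Fin.val_last]
  ring

end Tridiagonal

/-! ### The polynomials `Z` as tridiagonal determinants -/

theorem charmatrix_M (q : ℕ) :
    (M q).charmatrix = tridiag (fun i => X - C (if i + 1 = q then 1 else 2)) (fun _ => 1) q := by
  ext1 i j
  rw [Matrix.charmatrix_apply]
  by_cases h : i = j
  · subst h
    simp [M, tridiag]
  · have h' : (i : ℕ) ≠ j := fun h' => h (Fin.ext h')
    simp only [M, tridiag, Matrix.of_apply, Matrix.diagonal_apply_ne _ h, if_neg h, if_neg h']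
    by_cases h1 : (i : ℕ) + 1 = j
    · simp [h1]
    · by_cases h2 : (j : ℕ) + 1 = i <;> simp [h1, h2]

theorem Z_eq_det (q : ℕ) :
    Z q = (tridiag (fun i => X - C (if i + 1 = q then (1 : ℝ) else 2)) (fun _ => 1) q).det := by
  rw [← charmatrix_M]; rfl

/-- The last row has no superdiagonal entry, so `c (q - 1) = 0` only affects the diagonal, where it
turns `X - 2` into `X - 1`. -/
theorem Z_eq_det_of (q : ℕ) (d c : ℕ → ℝ[X]) (hd : ∀ i, d i = X - 1 - c i)
    (hc : ∀ i, i + 1 < q → c i = 1) (hq : ∀ i, i + 1 = q → c i = 0) :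
    (tridiag d c q).det = Z q := by
  rw [Z_eq_det]
  congr 1
  ext1 i j
  simp only [tridiag, Matrix.of_apply]
  have hi := i.2
  have hj := j.2
  by_cases h : (i : ℕ) + 1 = q
  · rw [if_neg (c := (i : ℕ) + 1 = j) (by omega), if_neg (c := (i : ℕ) + 1 = j) (by omega), hd,
      hq _ h, if_pos h]
    simp
  · rw [hd, hc _ (by omega), if_neg h]
    have : (X - 1 - 1 : ℝ[X]) = X - C 2 := by
      rw [show (C 2 : ℝ[X]) = 1 + 1 by rw [one_add_one_eq_two]; rfl]; ring
    rw [this]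

@[simp] theorem Z_zero : Z 0 = 1 := by simp [Z]

@[simp] theorem Z_one : Z 1 = X - 1 := by
  rw [Z_eq_det, Matrix.det_unique]
  simp [tridiag]

theorem Z_succ_succ (m : ℕ) : Z (m + 2) = (X - C 2) * Z (m + 1) - Z m := by
  rw [Z_eq_det, det_tridiag_succ_succ, Z_eq_det, Z_eq_det]
  simp [add_assoc]

theorem Z_monic (m : ℕ) : (Z m).Monic := Matrix.charpoly_monic _

theorem natDegree_Z (m : ℕ) : (Z m).natDegree = m := by
  simp [Z, Matrix.charpoly_natDegree_eq_dim]

theorem laplacian_of_adj {V : Type*} [Fintype V] [DecidableEq V] {Γ : Digraph V} {v w : V}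
    (hvw : v ≠ w) (h : Γ.Adj v w) : laplacian Γ v w = -1 := by
  simp [laplacian, hvw, h]

theorem laplacian_of_not_adj {V : Type*} [Fintype V] [DecidableEq V] {Γ : Digraph V} {v w : V}
    (hvw : v ≠ w) (h : ¬ Γ.Adj v w) : laplacian Γ v w = 0 := by
  simp [laplacian, hvw, h]

/-! ### The characteristic polynomial of a ring digraph -/

section Ring

variable {n : ℕ} {Γ : Digraph (ZMod n)}

theorem one_ne_zero_zmod (hn : 3 ≤ n) : (1 : ZMod n) ≠ 0 := by
  rw [← Nat.cast_one, Ne, ZMod.natCast_eq_zero_iff]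
  exact fun h => absurd (Nat.le_of_dvd one_pos h) (by omega)

theorem two_ne_zero_zmod (hn : 3 ≤ n) : (2 : ZMod n) ≠ 0 := by
  rw [← Nat.cast_two, Ne, ZMod.natCast_eq_zero_iff]
  exact fun h => absurd (Nat.le_of_dvd two_pos h) (by omega)

theorem sub_one_ne_add_one (hn : 3 ≤ n) (v : ZMod n) : v - 1 ≠ v + 1 := fun h =>
  two_ne_zero_zmod hn (by linear_combination -h)

theorem IsRing.adj_iff (hΓ : IsRing Γ) (v w : ZMod n) :
    Γ.Adj v w ↔ w = v - 1 ∨ (w = v + 1 ∧ Γ.Adj v (v + 1)) := by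
  constructor
  · intro h
    rcases hΓ.2 h with h' | h'
    · exact Or.inl h'
    · have h' : w = v + 1 := h'
      exact Or.inr ⟨h', h' ▸ h⟩
  · rintro (h | ⟨rfl, h⟩)
    · exact hΓ.1 h
    · exact h

/-- The arc from `v + 1` is always present, and `n ≥ 3` keeps `v - 1` distinct from `v + 1`. Missing
arcs thus correspond to their heads, the vertices of indegree 1. -/
theorem IsRing.indegree_eq_one_iff (hn : 3 ≤ n) (hΓ : IsRing Γ) (v : ZMod n) :
    indegree Γ v = 1 ↔ ¬ Γ.Adj (v - 1) v := by
  have key : ∀ u, Γ.Adj u v ↔ u = v + 1 ∨ (u = v - 1 ∧ Γ.Adj (v - 1) v) := by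
    intro u
    rw [hΓ.adj_iff]
    constructor
    · rintro (h | ⟨rfl, h⟩)
      · exact Or.inl (by linear_combination -h)
      · exact Or.inr ⟨by ring, by simpa using h⟩
    · rintro (rfl | ⟨rfl, h⟩)
      · exact Or.inl (by ring)
      · exact Or.inr ⟨by ring, by simpa using h⟩
  unfold indegree
  by_cases h : Γ.Adj (v - 1) v
  · have : {u | Γ.Adj u v} = {v + 1, v - 1} := by
      ext u; rw [Set.mem_ofPred_eq, key]; simp [h]
    rw [this, Set.ncard_pair (sub_one_ne_add_one hn v).symm]
    simp [h]
  · have : {u | Γ.Adj u v} = {v + 1} := by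
      ext u; rw [Set.mem_ofPred_eq, key]; simp [h]
    rw [this, Set.ncard_singleton]
    simp [h]

theorem ncard_missingArcs [NeZero n] (hn : 3 ≤ n) (hΓ : IsRing Γ) :
    (missingArcs Γ).ncard = ({v : ZMod n | indegree Γ v = 1} : Finset (ZMod n)).card := by
  rw [← Set.ncard_coe_finset]
  have : missingArcs Γ = (fun v : ZMod n => (v - 1, v)) ''
      ↑({v : ZMod n | indegree Γ v = 1} : Finset (ZMod n)) := by
    ext ⟨a, b⟩
    simp only [missingArcs, oppCycle, Set.mem_ofPred_eq, Finset.coe_filter, Finset.mem_univ,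
      true_and, Set.mem_image, hΓ.indegree_eq_one_iff hn, Prod.mk.injEq]
    constructor
    · rintro ⟨rfl, h⟩
      exact ⟨a + 1, by simpa using h, by ring, rfl⟩
    · rintro ⟨v, h, rfl, rfl⟩
      exact ⟨by ring, h⟩
  rw [this, Set.ncard_image_of_injective]
  intro v w h
  exact (Prod.mk.inj h).2

open Classical in
theorem IsRing.laplacian_apply_self [NeZero n] (hn : 3 ≤ n) (hΓ : IsRing Γ) (v : ZMod n) :
    laplacian Γ v v = 1 + if Γ.Adj v (v + 1) then 1 else 0 := by
  have h1 := one_ne_zero_zmod hn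
  have hs : ∑ k ∈ Finset.univ.erase v, (if Γ.Adj v k then (-1 : ℝ) else 0) =
      ∑ k ∈ {v - 1, v + 1}, (if Γ.Adj v k then (-1 : ℝ) else 0) := by
    symm
    apply Finset.sum_subset
    · intro k hk
      simp only [Finset.mem_insert, Finset.mem_singleton] at hk
      rcases hk with rfl | rfl <;> simp [h1]
    · intro k _ hk
      rw [if_neg]
      rw [hΓ.adj_iff]
      simp only [Finset.mem_insert, Finset.mem_singleton, not_or] at hk
      tauto
  simp only [laplacian, Matrix.of_apply, if_true]
  rw [hs, Finset.sum_pair (sub_one_ne_add_one hn v), if_pos (hΓ.1 rfl)]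
  split_ifs <;> ring

theorem natCast_add_one_eq_iff {i j : ℕ} (hi : i < n) (hj : j < n) :
    (j : ZMod n) + 1 = i ↔ j + 1 = i ∨ (i = 0 ∧ j + 1 = n) := by
  rw [← Nat.cast_succ, ZMod.natCast_eq_natCast_iff]
  unfold Nat.ModEq
  rw [Nat.mod_eq_of_lt hi]
  rcases Nat.lt_or_ge (j + 1) n with h | h
  · rw [Nat.mod_eq_of_lt h]; omega
  · have : j + 1 = n := by omega
    rw [Nat.succ_eq_add_one, this, Nat.mod_self]; omega

/-- The enumeration `r, r + 1, …` of the residues modulo `n`. -/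
noncomputable def enum (n : ℕ) [NeZero n] (r : ZMod n) : Fin n ≃ ZMod n :=
  Equiv.ofBijective (fun i => r + (i : ℕ)) <| by
    rw [Fintype.bijective_iff_injective_and_card]
    refine ⟨fun i j h => ?_, by simp [ZMod.card]⟩
    have h' : ((i : ℕ) : ZMod n) = (j : ℕ) := add_left_cancel h
    rw [ZMod.natCast_eq_natCast_iff, Nat.ModEq, Nat.mod_eq_of_lt i.2, Nat.mod_eq_of_lt j.2] at h'
    exact Fin.ext h'

theorem enum_apply [NeZero n] (r : ZMod n) (i : Fin n) : enum n r i = r + (i : ℕ) := rfl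

theorem IsRing.charpoly_eq_det [NeZero n] (hn : 3 ≤ n) (hΓ : IsRing Γ) {r : ZMod n}
    (hr : indegree Γ r = 1) (c : ℕ → ℝ[X])
    (hc : ∀ i : ℕ, c i = if indegree Γ (r + (i + 1 : ℕ)) = 1 then 0 else 1) :
    (laplacian Γ).charpoly = (tridiag (fun i => X - 1 - c i) c n).det - (-1) ^ n := by
  have hadj : ∀ i : ℕ, Γ.Adj (r + i) (r + i + 1) ↔ ¬ indegree Γ (r + (i + 1 : ℕ)) = 1 := by
    intro i
    rw [hΓ.indegree_eq_one_iff hn, not_not, Nat.cast_succ, ← add_assoc, add_sub_cancel_right]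
  rw [Matrix.charpoly, ← Matrix.det_submatrix_equiv_self (enum n r)]
  have key : ∀ i j : Fin n, (laplacian Γ).charmatrix (enum n r i) (enum n r j) =
      tridiag (fun i => X - 1 - c i) c n i j +
        if (i : ℕ) = 0 ∧ (j : ℕ) + 1 = n then 1 else 0 := by
    intro i j
    rw [Matrix.charmatrix_apply]
    by_cases h : i = j
    · subst h
      rw [Matrix.diagonal_apply_eq, hΓ.laplacian_apply_self hn,
        if_neg (c := (i : ℕ) = 0 ∧ (i : ℕ) + 1 = n) (by omega)]
      simp only [tridiag, Matrix.of_apply, if_true]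
      have := hadj i
      rw [← enum_apply] at this
      by_cases h1 : indegree Γ (r + ((i : ℕ) + 1 : ℕ)) = 1
      · rw [if_neg (this.not.2 (not_not.2 h1)), hc, if_pos h1]
        simp
      · rw [if_pos (this.2 h1), hc, if_neg h1]
        simp [sub_sub]
    · have h' : (i : ℕ) ≠ j := fun h' => h (Fin.ext h')
      have he : enum n r i ≠ enum n r j := fun h' => h ((enum n r).injective h')
      rw [Matrix.diagonal_apply_ne _ he]
      simp only [tridiag, Matrix.of_apply, if_neg h']
      have e1 : enum n r j = enum n r i - 1 ↔
          (j : ℕ) + 1 = i ∨ ((i : ℕ) = 0 ∧ (j : ℕ) + 1 = n) := by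
        rw [← natCast_add_one_eq_iff i.2 j.2, enum_apply, enum_apply]
        constructor <;> intro h
        · linear_combination h
        · linear_combination h
      have e2 : enum n r j = enum n r i + 1 ↔
          (i : ℕ) + 1 = j ∨ ((j : ℕ) = 0 ∧ (i : ℕ) + 1 = n) := by
        rw [← natCast_add_one_eq_iff j.2 i.2, enum_apply, enum_apply]
        constructor <;> intro h
        · linear_combination -h
        · linear_combination -h
      have hA := hΓ.adj_iff (enum n r i) (enum n r j)
      rw [e1, e2, enum_apply r i, hadj, ← enum_apply r i] at hA
      have hv : (0 : ℝ[X]) - C (-1) = 1 := by simp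
      have hv' : (0 : ℝ[X]) - C 0 = 0 := by simp
      by_cases h1 : (i : ℕ) + 1 = j
      · have h2 : ¬ (j : ℕ) + 1 = i := by omega
        have h3 : ¬ ((i : ℕ) = 0 ∧ (j : ℕ) + 1 = n) := by omega
        rw [if_pos h1, if_neg h3, hc]
        by_cases h4 : indegree Γ (r + ((i : ℕ) + 1 : ℕ)) = 1
        · rw [laplacian_of_not_adj he fun h => (hA.1 h).elim (not_or.2 ⟨h2, h3⟩) fun h => h.2 h4,
            if_pos h4, hv', add_zero]
        · rw [laplacian_of_adj he (hA.2 (Or.inr ⟨Or.inl h1, h4⟩)), if_neg h4, hv, add_zero]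
      · rw [if_neg h1]
        by_cases h2 : (j : ℕ) + 1 = i
        · have h3 : ¬ ((i : ℕ) = 0 ∧ (j : ℕ) + 1 = n) := by omega
          rw [laplacian_of_adj he (hA.2 (Or.inl (Or.inl h2))), if_pos h2, if_neg h3, hv, add_zero]
        · rw [if_neg h2]
          by_cases h3 : (i : ℕ) = 0 ∧ (j : ℕ) + 1 = n
          · rw [laplacian_of_adj he (hA.2 (Or.inl (Or.inr h3))), if_pos h3, hv, zero_add]
          · have h4 : ¬ (((i : ℕ) + 1 = j ∨ ((j : ℕ) = 0 ∧ (i : ℕ) + 1 = n)) ∧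
                ¬ indegree Γ (r + ((i : ℕ) + 1 : ℕ)) = 1) := by
              rintro ⟨h4 | h4, h5⟩
              · exact h1 h4
              -- The lower left corner: its arc would enter `r`, which has indegree 1.
              · rw [h4.2, CharP.cast_eq_zero, add_zero] at h5
                exact h5 hr
            rw [laplacian_of_not_adj he fun h => (hA.1 h).elim (not_or.2 ⟨h2, h3⟩) h4,
              if_neg h3, hv', add_zero]
  obtain ⟨k, rfl⟩ : ∃ k, n = k + 2 := ⟨n - 2, by omega⟩
  rw [det_tridiag_add_corner (fun i => X - 1 - c i) c k]
  intro i j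
  rw [Matrix.submatrix_apply, key]
  congr 1
  simp only [Fin.ext_iff, Fin.val_zero, Fin.val_last,
    show ∀ j : ℕ, (j + 1 = k + 2 ↔ j = k + 1) from fun j => by omega]

theorem pathLength_spec [NeZero n] {v : ZMod n} (hv : indegree Γ v = 1) :
    0 < pathLength Γ v ∧ indegree Γ (v - (pathLength Γ v : ZMod n)) = 1 :=
  Nat.sInf_mem (s := {d : ℕ | 0 < d ∧ indegree Γ (v - (d : ZMod n)) = 1})
    -- A full turn returns to `v`, so the infimum is attained and is not the default 0.
    ⟨n, Nat.pos_of_ne_zero (NeZero.ne n), by simpa using hv⟩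

theorem pathLength_le {v : ZMod n} {d : ℕ} (hd : 0 < d)
    (h : indegree Γ (v - (d : ZMod n)) = 1) : pathLength Γ v ≤ d :=
  Nat.sInf_le ⟨hd, h⟩

/-- Paths run downwards, so the path starting at `r + m` is the last diagonal block. Peel it off;
`c` vanishes just before the block and at its end, and is 1 in between. -/
theorem det_tridiag_eq_prod [NeZero n] {r : ZMod n}
    (hr : indegree Γ r = 1) (c : ℕ → ℝ[X])
    (hc : ∀ i : ℕ, c i = if indegree Γ (r + (i + 1 : ℕ)) = 1 then 0 else 1) (m : ℕ)
    (hm : indegree Γ (r + m) = 1) :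
    (tridiag (fun i => X - 1 - c i) c m).det =
      ∏ i ∈ Finset.Ioc 0 m with indegree Γ (r + (i : ℕ)) = 1,
        Z (pathLength Γ (r + (i : ℕ))) := by
  induction m using Nat.strong_induction_on with
  | _ m ih =>
    rcases Nat.eq_zero_or_pos m with rfl | hm0
    · simp
    obtain ⟨hl0, hl⟩ := pathLength_spec hm
    have hle : pathLength Γ (r + m) ≤ m := pathLength_le hm0 (by simpa using hr)
    generalize hL : pathLength Γ (r + m) = l at *
    obtain ⟨p, rfl⟩ := Nat.exists_eq_add_of_le' hle
    have hp : indegree Γ (r + (p : ZMod n)) = 1 := by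
      convert hl using 2
      push_cast
      ring
    have hcut : ∀ i, p < i → i < p + l → ¬ indegree Γ (r + (i : ZMod n)) = 1 := by
      intro i h1 h2 h
      have := pathLength_le (Γ := Γ) (v := r + ((p + l : ℕ) : ZMod n)) (d := p + l - i) (by omega)
        (by
          rw [Nat.cast_sub h2.le]
          convert h using 2
          ring)
      omega
    rw [det_tridiag_add, ih p (by omega) hp, Z_eq_det_of]
    · have : (Finset.Ioc 0 (p + l)).filter (fun i : ℕ => indegree Γ (r + (i : ZMod n)) = 1) =
          insert (p + l) ((Finset.Ioc 0 p).filter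
            (fun i : ℕ => indegree Γ (r + (i : ZMod n)) = 1)) := by
        ext i
        simp only [Finset.mem_filter, Finset.mem_Ioc, Finset.mem_insert]
        constructor
        · rintro ⟨⟨h1, h2⟩, h3⟩
          by_cases h4 : i = p + l
          · exact Or.inl h4
          · refine Or.inr ⟨⟨h1, ?_⟩, h3⟩
            by_contra h5
            exact hcut i (by omega) (by omega) h3
        · rintro (rfl | ⟨⟨h1, h2⟩, h3⟩)
          · exact ⟨⟨hm0, le_rfl⟩, hm⟩
          · exact ⟨⟨h1, by omega⟩, h3⟩
      rw [this, Finset.prod_insert (by simp; omega), hL, mul_comm]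
    · exact fun i => rfl
    · intro i hi
      rw [hc, if_neg (hcut _ (by omega) (by omega))]
    · intro i hi
      rw [hc, if_pos]
      rwa [add_assoc, hi]
    · intro i hi
      rw [hc, if_pos]
      rwa [hi]

theorem IsRing.charpoly_laplacian [NeZero n] (hn : 3 ≤ n) (hΓ : IsRing Γ) {r : ZMod n}
    (hr : indegree Γ r = 1) :
    (laplacian Γ).charpoly =
      (∏ v : ZMod n with indegree Γ v = 1, Z (pathLength Γ v)) - (-1) ^ n := by
  rw [hΓ.charpoly_eq_det hn hr _ (fun _ => rfl), det_tridiag_eq_prod hr _ (fun _ => rfl) n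
    (by simpa using hr)]
  congr 1
  refine Finset.prod_bij (fun i _ => r + (i : ZMod n)) ?_ ?_ ?_ ?_
  · intro i hi
    simpa using (Finset.mem_filter.1 hi).2
  · intro i hi j hj h
    have hi := Finset.mem_Ioc.1 (Finset.mem_filter.1 hi).1
    have hj := Finset.mem_Ioc.1 (Finset.mem_filter.1 hj).1
    have h' := (ZMod.natCast_eq_natCast_iff' _ _ _).1 (add_left_cancel h)
    rcases hi.2.lt_or_eq with h1 | h1 <;> rcases hj.2.lt_or_eq with h2 | h2
    · rwa [Nat.mod_eq_of_lt h1, Nat.mod_eq_of_lt h2] at h'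
    · rw [Nat.mod_eq_of_lt h1, h2, Nat.mod_self] at h'; omega
    · rw [Nat.mod_eq_of_lt h2, h1, Nat.mod_self] at h'; omega
    · omega
  · intro v hv
    have hv := (Finset.mem_filter.1 hv).2
    by_cases h : v = r
    -- The range `Ioc 0 n` represents `r` by the index `n`, not by 0.
    · exact ⟨n, by simp [hr, Nat.pos_of_ne_zero (NeZero.ne n)], by simp [h]⟩
    · have e : r + ((v - r).val : ZMod n) = v := by simp
      refine ⟨(v - r).val, ?_, e⟩
      simp only [Finset.mem_filter, Finset.mem_Ioc, e]
      refine ⟨⟨Nat.pos_of_ne_zero ?_, (ZMod.val_lt _).le⟩, hv⟩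
      rw [Ne, ZMod.val_eq_zero, sub_eq_zero]
      exact h
  · intro i _
    rfl

/-- Compare degrees in `IsRing.charpoly_laplacian`. -/
theorem IsRing.sum_pathLength [NeZero n] (hn : 3 ≤ n) (hΓ : IsRing Γ) {r : ZMod n}
    (hr : indegree Γ r = 1) :
    ∑ v : ZMod n with indegree Γ v = 1, pathLength Γ v = n := by
  have h := hΓ.charpoly_laplacian hn hr
  have h1 := congrArg natDegree h
  rw [Matrix.charpoly_natDegree_eq_dim, ZMod.card,
    show ((-1) ^ n : ℝ[X]) = C ((-1) ^ n) by simp, natDegree_sub_C,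
    natDegree_prod_of_monic _ _ (fun _ _ => Z_monic _)] at h1
  simpa [natDegree_Z] using h1.symm

end Ring

/-! ### Rolle's theorem and loss of real roots -/

section Rolle

/-- Between consecutive distinct roots in `I` the derivative has a zero, again in `I` by
order-connectedness, and each multiple root loses only one in multiplicity. -/
theorem card_filter_roots_le_derivative (p : ℝ[X]) {I : Set ℝ} [DecidablePred (· ∈ I)]
    (hI : I.OrdConnected) :
    (p.roots.filter (· ∈ I)).card ≤ (p.derivative.roots.filter (· ∈ I)).card + 1 := by
  rcases eq_or_ne (derivative p) 0 with hp' | hp'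
  · rw [eq_C_of_derivative_eq_zero hp']
    simp
  have hp : p ≠ 0 := ne_of_apply_ne derivative (by rwa [derivative_zero])
  set P := p.roots.filter (· ∈ I) with hP
  set Q := p.derivative.roots.filter (· ∈ I) with hQ
  have hcard : P.toFinset.card ≤ (Q.toFinset \ P.toFinset).card + 1 := by
    refine Finset.card_le_sdiff_of_interleaved fun x hx y hy hxy hxy' => ?_
    rw [Multiset.mem_toFinset, Multiset.mem_filter, mem_roots hp] at hx hy
    obtain ⟨z, hz1, hz2⟩ := exists_deriv_eq_zero hxy p.continuousOn (hx.1.trans hy.1.symm)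
    refine ⟨z, ?_, hz1⟩
    rw [Multiset.mem_toFinset, Multiset.mem_filter, mem_roots hp', IsRoot, ← p.deriv]
    exact ⟨hz2, hI.out hx.2 hy.2 ⟨hz1.1.le, hz1.2.le⟩⟩
  have hle : ∀ x ∈ P.toFinset, P.count x - 1 ≤ Q.count x := by
    intro x hx
    have hxI : x ∈ I := (Multiset.mem_filter.1 (Multiset.mem_toFinset.1 hx)).2
    rw [hP, hQ, Multiset.count_filter_of_pos hxI, Multiset.count_filter_of_pos hxI, count_roots,
      count_roots]
    exact rootMultiplicity_sub_one_le_derivative_rootMultiplicity _ _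
  calc
    P.card = ∑ x ∈ P.toFinset, P.count x := (Multiset.toFinset_sum_count_eq _).symm
    _ = ∑ x ∈ P.toFinset, (P.count x - 1 + 1) :=
      (Eq.symm <| Finset.sum_congr rfl fun _ hx => tsub_add_cancel_of_le <|
        Nat.succ_le_iff.2 <| Multiset.count_pos.2 <| Multiset.mem_toFinset.1 hx)
    _ = (∑ x ∈ P.toFinset, (P.count x - 1)) + P.toFinset.card := by
      simp only [Finset.sum_add_distrib, Finset.card_eq_sum_ones]
    _ ≤ (∑ x ∈ P.toFinset, Q.count x) + ((Q.toFinset \ P.toFinset).card + 1) :=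
      add_le_add (Finset.sum_le_sum hle) hcard
    _ ≤ (∑ x ∈ P.toFinset, Q.count x) +
          ((∑ x ∈ Q.toFinset \ P.toFinset, Q.count x) + 1) := by
      simp only [Finset.card_eq_sum_ones]
      gcongr with x hx
      rw [Nat.succ_le_iff, Multiset.count_pos, ← Multiset.mem_toFinset]
      exact (Finset.mem_sdiff.1 hx).1
    _ = Q.card + 1 := by
      rw [← add_assoc, ← Finset.sum_union Finset.disjoint_sdiff, Finset.union_sdiff_self_eq_union,
        ← Multiset.toFinset_sum_count_eq, ← Finset.sum_subset Finset.subset_union_right]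
      intro x _ hx₂
      simpa only [Multiset.mem_toFinset, Multiset.count_eq_zero] using hx₂

/-- A constant shift that removes three roots from an interval destroys real-rootedness. -/
theorem not_splits_sub_C {f : ℝ[X]} {a b c : ℝ} {t : Multiset ℝ}
    (ht : t ≤ f.roots) (htI : ∀ x ∈ t, x ∈ Set.Ioc a b) (ht3 : 3 ≤ t.card)
    (hc : ∀ x ∈ Set.Ioc a b, f.eval x ≠ c) : ¬ (f - C c).Splits := by
  classical
  intro hs
  have hcount := hs.natDegree_eq_card_roots
  rw [natDegree_sub_C] at hcount
  have hd : derivative (f - C c) = derivative f := by simp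
  have hpos : 3 ≤ f.natDegree :=
    (ht3.trans (Multiset.card_le_card ht)).trans (card_roots' f)
  have hne : f - C c ≠ 0 := fun h => by
    rw [h] at hcount; simp at hcount; omega
  -- Using `max a b` makes the three pieces a partition of the line even when `b < a`.
  have split : ∀ s : Multiset ℝ, s.card = (s.filter (· ∈ Set.Iic a)).card +
      (s.filter (· ∈ Set.Ioc a b)).card + (s.filter (· ∈ Set.Ioi (max a b))).card := by
    intro s
    induction s using Multiset.induction_on with
    | empty => simp
    | cons x s ih =>
      rw [Multiset.card_cons, ih]
      by_cases h1 : x ≤ a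
      · have h2 : ¬ a < x := not_lt.2 h1
        simp [h1, h2]; omega
      · have h2 : a < x := not_le.1 h1
        by_cases h3 : x ≤ b
        · have h4 : ¬ b < x := not_lt.2 h3
          simp [h1, h2, h3, h4]; omega
        · have h4 : b < x := not_le.1 h3
          simp [h1, h2, h3, h4]; omega
  have h0 : ((f - C c).roots.filter (· ∈ Set.Ioc a b)).card = 0 := by
    rw [Multiset.card_eq_zero, Multiset.filter_eq_nil]
    intro x hx hxI
    rw [mem_roots hne, IsRoot, eval_sub, eval_C, sub_eq_zero] at hx
    exact hc x hxI hx
  have h3 : 3 ≤ (f.roots.filter (· ∈ Set.Ioc a b)).card := by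
    refine ht3.trans (Multiset.card_le_card ?_)
    exact Multiset.le_filter.2 ⟨ht, htI⟩
  -- If `f - c` splits, its `deg f` roots all lie in the two outer pieces, so `f'` has at least `deg
  -- f - 2` roots there. The middle piece supplies two more, exceeding the degree of `f'`.
  have r1 := card_filter_roots_le_derivative (f - C c) (Set.ordConnected_Iic (a := a))
  have r2 := card_filter_roots_le_derivative (f - C c) (Set.ordConnected_Ioi (a := max a b))
  have r3 := card_filter_roots_le_derivative f
    (show (Set.Ioc a b).OrdConnected from Set.ordConnected_Ioc)
  have e1 := split (f - C c).roots
  have e2 := split (derivative f).roots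
  have e3 := card_roots' (derivative f)
  have e4 := natDegree_derivative_lt (p := f) (by omega)
  rw [hd] at r1 r2
  omega

end Rolle

/-! ### The substitution `λ = 4 sin² s` -/

section Trigonometric

/-- At `X = 4 sin² s` the factor `X - 2` is `-2 cos 2s`, so the recurrence for `Z` is the addition
formula for cosines in steps of `2s`. Multiplying by `cos s` avoids dividing by it. -/
theorem aeval_Z_mul_cos (m : ℕ) (s : ℂ) :
    aeval (4 * Complex.sin s ^ 2) (Z m) * Complex.cos s =
      (-1) ^ m * Complex.cos ((2 * m + 1) * s) := by
  induction m using Nat.twoStepInduction with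
  | zero => simp
  | one =>
    have h : ((2 * ((1 : ℕ) : ℂ) + 1) * s) = 3 * s := by push_cast; ring
    rw [h, Complex.cos_three_mul, Z_one]
    simp only [map_sub, aeval_X, map_one, Complex.sin_sq]
    ring
  | more m h0 h1 =>
    have hs : Complex.cos ((2 * ((m + 2 : ℕ) : ℂ) + 1) * s) =
        2 * Complex.cos (2 * s) * Complex.cos ((2 * ((m + 1 : ℕ) : ℂ) + 1) * s) -
          Complex.cos ((2 * (m : ℂ) + 1) * s) := by
      have e1 : (2 * ((m + 2 : ℕ) : ℂ) + 1) * s = (2 * ((m + 1 : ℕ) : ℂ) + 1) * s + 2 * s := by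
        push_cast; ring
      have e2 : (2 * (m : ℂ) + 1) * s = (2 * ((m + 1 : ℕ) : ℂ) + 1) * s - 2 * s := by
        push_cast; ring
      rw [e1, e2, Complex.cos_add, Complex.cos_sub]
      ring
    rw [Z_succ_succ, hs, Complex.cos_two_mul']
    have hC : aeval (4 * Complex.sin s ^ 2) (C (2 : ℝ)) = (2 : ℂ) := by
      rw [aeval_C]; simp
    rw [map_sub, map_mul, map_sub, aeval_X, hC, sub_mul, h0, mul_assoc, h1, Complex.cos_sq']
    ring

theorem eval_Z_mul_cos (m : ℕ) (s : ℝ) :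
    (Z m).eval (4 * Real.sin s ^ 2) * Real.cos s = (-1) ^ m * Real.cos ((2 * m + 1) * s) := by
  have h := aeval_Z_mul_cos m s
  have e : (4 * Complex.sin s ^ 2 : ℂ) = algebraMap ℝ ℂ (4 * Real.sin s ^ 2) := by simp
  rw [e, aeval_algebraMap_apply, coe_aeval_eq_eval] at h
  rw [← Complex.ofReal_inj]
  simpa using h

theorem isRoot_Z {m : ℕ} {s : ℝ} (hs : 0 < Real.cos s) (h : Real.cos ((2 * m + 1) * s) = 0) :
    (Z m).IsRoot (4 * Real.sin s ^ 2) := by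
  have := eval_Z_mul_cos m s
  rw [h, mul_zero] at this
  exact (mul_eq_zero.1 this).resolve_right hs.ne'

theorem four_mul_sin_sq_mem_Ioc {s s₀ : ℝ} (hs : 0 < s) (hss : s ≤ s₀) (hs₀ : s₀ < Real.pi / 2) :
    4 * Real.sin s ^ 2 ∈ Set.Ioc 0 (4 * Real.sin s₀ ^ 2) := by
  have hpi := Real.pi_pos
  have h1 : 0 < Real.sin s := Real.sin_pos_of_pos_of_lt_pi hs (by linarith)
  have h2 : Real.sin s ≤ Real.sin s₀ :=
    Real.sin_le_sin_of_le_of_le_pi_div_two (by linarith) hs₀.le hss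
  exact ⟨by positivity, by gcongr⟩

theorem exists_four_mul_sin_sq {x s₀ : ℝ} (hs₀ : 0 < s₀) (hx : x ∈ Set.Ioc 0 (4 * Real.sin s₀ ^ 2)) :
    ∃ s ∈ Set.Ioc 0 s₀, x = 4 * Real.sin s ^ 2 := by
  have hpi := Real.pi_pos
  have hc : ContinuousOn (fun s => 4 * Real.sin s ^ 2) (Set.Icc 0 s₀) := by fun_prop
  obtain ⟨s, hs, rfl⟩ := intermediate_value_Icc hs₀.le hc
    (show x ∈ Set.Icc (4 * Real.sin 0 ^ 2) (4 * Real.sin s₀ ^ 2) by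
      simpa using ⟨hx.1.le, hx.2⟩)
  refine ⟨s, ⟨lt_of_le_of_ne hs.1 ?_, hs.2⟩, rfl⟩
  rintro rfl
  simp at hx

theorem not_splits_sub_C_of_trig {f : ℝ[X]} {c s₀ : ℝ} (hs₀ : 0 < s₀)
    (hs₀' : s₀ < Real.pi / 2) {t : Multiset ℝ} (ht : t.map (fun s => 4 * Real.sin s ^ 2) ≤ f.roots)
    (htI : ∀ s ∈ t, s ∈ Set.Ioc 0 s₀) (ht3 : 3 ≤ t.card)
    (hc : ∀ s ∈ Set.Ioc 0 s₀, f.eval (4 * Real.sin s ^ 2) ≠ c) : ¬ (f - C c).Splits := by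
  refine not_splits_sub_C (a := 0) (b := 4 * Real.sin s₀ ^ 2) ht ?_ (by simpa using ht3) ?_
  · intro x hx
    obtain ⟨s, hs, rfl⟩ := Multiset.mem_map.1 hx
    exact four_mul_sin_sq_mem_Ioc (htI s hs).1 (htI s hs).2 hs₀'
  · intro x hx
    obtain ⟨s, hs, rfl⟩ := exists_four_mul_sin_sq hs₀ hx
    exact hc s hs

/-- Monotonicity reduces to `cos 3s = cos³ s - 3 cos s sin² s`. The cube pays for three factors:
this one and two others that are merely bounded by 1. -/
theorem cos_odd_mul_lt {m : ℕ} (hm : 1 ≤ m) {s : ℝ} (hs : 0 < s)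
    (h : (2 * m + 1) * s ≤ Real.pi / 2) :
    |Real.cos ((2 * m + 1) * s)| < Real.cos s ^ 3 := by
  have hpi := Real.pi_pos
  have hm' : (1 : ℝ) ≤ m := by exact_mod_cast hm
  have h3 : 3 * s ≤ (2 * m + 1) * s := by nlinarith
  have h0 : 0 ≤ Real.cos ((2 * m + 1) * s) :=
    Real.cos_nonneg_of_mem_Icc ⟨by linarith, h⟩
  rw [abs_of_nonneg h0]
  have h1 : Real.cos ((2 * m + 1) * s) ≤ Real.cos (3 * s) :=
    Real.cos_le_cos_of_nonneg_of_le_pi (by linarith) (by linarith) h3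
  have hc : 0 < Real.cos s := Real.cos_pos_of_mem_Ioo ⟨by linarith, by linarith⟩
  have hsin : 0 < Real.sin s := Real.sin_pos_of_pos_of_lt_pi hs (by linarith)
  have h2 := Real.sin_sq_add_cos_sq s
  rw [Real.cos_three_mul] at h1
  have : 0 < Real.cos s * Real.sin s ^ 2 := by positivity
  nlinarith

theorem abs_cos_odd_mul_le {m : ℕ} {s : ℝ} (hs : 0 < s)
    (h : (2 * m + 1) * s ≤ Real.pi / 2) :
    |Real.cos ((2 * m + 1) * s)| ≤ Real.cos s := by
  have hpi := Real.pi_pos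
  have h3 : s ≤ (2 * m + 1) * s := by
    have : 0 ≤ (m : ℝ) * s := by positivity
    linarith
  rw [abs_of_nonneg (Real.cos_nonneg_of_mem_Icc ⟨by linarith, h⟩)]
  exact Real.cos_le_cos_of_nonneg_of_le_pi hs.le (by linarith) h3

theorem cos_first_root (m : ℕ) : Real.cos ((2 * m + 1) * (Real.pi / (2 * (2 * m + 1)))) = 0 := by
  have : (2 * (m : ℝ) + 1) * (Real.pi / (2 * (2 * m + 1))) = Real.pi / 2 := by field_simp
  rw [this, Real.cos_pi_div_two]

theorem cos_second_root (m : ℕ) :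
    Real.cos ((2 * m + 1) * (3 * Real.pi / (2 * (2 * m + 1)))) = 0 := by
  have : (2 * (m : ℝ) + 1) * (3 * Real.pi / (2 * (2 * m + 1))) = Real.pi / 2 + Real.pi := by
    field_simp; ring
  rw [this, Real.cos_add_pi, Real.cos_pi_div_two, neg_zero]

end Trigonometric

/-! ### Products of `Z` whose shifts do not split -/

section NonReal

theorem abs_eval_prod_Z_mul_cos {ι : Type*} (S : Finset ι) (m : ι → ℕ) (s : ℝ)
    (hs : 0 < Real.cos s) :
    |(∏ v ∈ S, Z (m v)).eval (4 * Real.sin s ^ 2)| * Real.cos s ^ S.card =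
      ∏ v ∈ S, |Real.cos ((2 * m v + 1) * s)| := by
  rw [eval_prod, Finset.abs_prod, ← Finset.prod_const, ← Finset.prod_mul_distrib]
  refine Finset.prod_congr rfl fun v _ => ?_
  conv_lhs => rw [← abs_of_pos hs]
  rw [← abs_mul, eval_Z_mul_cos, abs_mul]
  simp

theorem pi_div_odd_pos (m : ℕ) : 0 < Real.pi / (2 * (2 * m + 1)) := by
  have := Real.pi_pos
  positivity

theorem pi_div_odd_anti {m k : ℕ} (h : m ≤ k) :
    Real.pi / (2 * (2 * k + 1)) ≤ Real.pi / (2 * (2 * m + 1)) := by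
  have := Real.pi_pos
  have : (m : ℝ) ≤ k := by exact_mod_cast h
  gcongr

theorem pi_div_odd_lt {m : ℕ} (h : 1 ≤ m) : Real.pi / (2 * (2 * m + 1)) < Real.pi / 2 := by
  have := Real.pi_pos
  have : (1 : ℝ) ≤ m := by exact_mod_cast h
  rw [div_lt_div_iff₀ (by positivity) (by positivity)]
  nlinarith

theorem cos_pos_of_mem_Ioc {s s₀ : ℝ} (hs : s ∈ Set.Ioc 0 s₀) (h : s₀ < Real.pi / 2) :
    0 < Real.cos s :=
  Real.cos_pos_of_mem_Ioo ⟨by linarith [hs.1, Real.pi_pos], by linarith [hs.2]⟩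

theorem X_sub_C_dvd_Z {m : ℕ} (hm : 1 ≤ m) :
    X - C (4 * Real.sin (Real.pi / (2 * (2 * m + 1))) ^ 2) ∣ Z m :=
  dvd_iff_isRoot.2 <| isRoot_Z
    (cos_pos_of_mem_Ioc ⟨pi_div_odd_pos m, le_rfl⟩ (pi_div_odd_lt hm)) (cos_first_root m)

theorem prod_Z_ne_zero {ι : Type*} (S : Finset ι) (m : ι → ℕ) : ∏ v ∈ S, Z (m v) ≠ 0 :=
  (monic_prod_of_monic _ _ fun _ _ => Z_monic _).ne_zero

theorem mul_odd_le_of_le {m : ℕ} {s : ℝ} (h : s ≤ Real.pi / (2 * (2 * m + 1))) :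
    (2 * m + 1) * s ≤ Real.pi / 2 := by
  rw [le_div_iff₀ (by positivity)] at h
  linarith

/-- Let `a`, `b`, `d` carry the three largest values of `m`. Their first zeros lie in `(0, s₀]`,
with `s₀` that of `d`. There the factors of `a` and `b` are bounded by 1, that of `d` by `cos³ s`
strictly, and each other one by `cos s`, so the product of the `Z` has absolute value less than 1.
-/
theorem not_splits_prod_Z_sub_C {ι : Type*} [DecidableEq ι] (S : Finset ι) (m : ι → ℕ)
    (hm : ∀ v ∈ S, 1 ≤ m v) (hS : 3 ≤ S.card) {c : ℝ} (hc : |c| = 1) :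
    ¬ (∏ v ∈ S, Z (m v) - C c).Splits := by
  obtain ⟨a, ha, hamax⟩ := S.exists_max_image m (Finset.card_pos.1 (by omega))
  have hc1 := Finset.card_erase_of_mem ha
  obtain ⟨b, hb, hbmax⟩ := (S.erase a).exists_max_image m (Finset.card_pos.1 (by omega))
  have hc2 := Finset.card_erase_of_mem hb
  obtain ⟨d, hd, hdmax⟩ := ((S.erase a).erase b).exists_max_image m
    (Finset.card_pos.1 (by omega))
  have hc3 := Finset.card_erase_of_mem hd
  have hbS := Finset.mem_of_mem_erase hb
  have hd1 := Finset.mem_of_mem_erase hd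
  have hdS := Finset.mem_of_mem_erase hd1
  set T := ((S.erase a).erase b).erase d with hT
  have hprod : ∀ {M : Type} [CommMonoid M] (g : ι → M),
      ∏ v ∈ S, g v = g a * (g b * (g d * ∏ v ∈ T, g v)) := by
    intro M _ g
    rw [Finset.mul_prod_erase _ _ hd, Finset.mul_prod_erase _ _ hb, Finset.mul_prod_erase _ _ ha]
  have hs₀' := pi_div_odd_lt (hm d hdS)
  refine not_splits_sub_C_of_trig (pi_div_odd_pos (m d)) hs₀'
    (t := {Real.pi / (2 * (2 * m a + 1)), Real.pi / (2 * (2 * m b + 1)),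
      Real.pi / (2 * (2 * m d + 1))}) ?_ ?_ (by simp) ?_
  · rw [← Multiset.prod_X_sub_C_dvd_iff_le_roots (prod_Z_ne_zero S m), hprod]
    simp only [Multiset.insert_eq_cons, Multiset.map_cons, Multiset.map_singleton,
      Multiset.prod_cons, Multiset.prod_singleton]
    exact mul_dvd_mul (X_sub_C_dvd_Z (hm a ha)) (mul_dvd_mul (X_sub_C_dvd_Z (hm b hbS))
      ((X_sub_C_dvd_Z (hm d hdS)).mul_right _))
  · simp only [Multiset.insert_eq_cons, Multiset.mem_cons, Multiset.mem_singleton]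
    rintro s (rfl | rfl | rfl)
    · exact ⟨pi_div_odd_pos _, pi_div_odd_anti (hamax d hdS)⟩
    · exact ⟨pi_div_odd_pos _, pi_div_odd_anti (hbmax d hd1)⟩
    · exact ⟨pi_div_odd_pos _, le_rfl⟩
  · intro s hs heq
    have hcos := cos_pos_of_mem_Ioc hs hs₀'
    have h := abs_eval_prod_Z_mul_cos S m s hcos
    rw [heq, hc, one_mul, hprod] at h
    have h1 := Real.abs_cos_le_one ((2 * m a + 1) * s)
    have h2 := Real.abs_cos_le_one ((2 * m b + 1) * s)
    have h3 := cos_odd_mul_lt (hm d hdS) hs.1 (mul_odd_le_of_le hs.2)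
    have h4 : ∏ v ∈ T, |Real.cos ((2 * m v + 1) * s)| ≤ Real.cos s ^ T.card := by
      rw [← Finset.prod_const]
      refine Finset.prod_le_prod (fun _ _ => abs_nonneg _) fun v hv => ?_
      exact abs_cos_odd_mul_le hs.1 (mul_odd_le_of_le
        (hs.2.trans (pi_div_odd_anti (hdmax v (Finset.mem_of_mem_erase hv)))))
    have hT3 : S.card = 3 + T.card := by omega
    rw [hT3, pow_add] at h
    have hTpos : 0 < Real.cos s ^ T.card := by positivity
    have h5 : |Real.cos ((2 * m d + 1) * s)| * ∏ v ∈ T, |Real.cos ((2 * m v + 1) * s)| <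
        Real.cos s ^ 3 * Real.cos s ^ T.card :=
      (mul_le_mul_of_nonneg_left h4 (abs_nonneg _)).trans_lt (mul_lt_mul_of_pos_right h3 hTpos)
    have h6 : 0 ≤ |Real.cos ((2 * m d + 1) * s)| * ∏ v ∈ T, |Real.cos ((2 * m v + 1) * s)| :=
      mul_nonneg (abs_nonneg _) (Finset.prod_nonneg fun _ _ => abs_nonneg _)
    have h7 := mul_le_mul h1 (mul_le_of_le_one_left h6 h2) (by positivity) zero_le_one
    rw [one_mul] at h7
    linarith

/-- The three roots are the first two of `Z p` and the first of `Z q`; the interval ends at the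
largest of them. -/
theorem not_splits_Z_mul_Z_sub_C {p q : ℕ} (hq : 1 ≤ q) (hpq : q + 2 ≤ p) :
    ¬ (Z p * Z q - C ((-1) ^ (p + q))).Splits := by
  have hpi := Real.pi_pos
  have hne : Z p * Z q ≠ 0 := ((Z_monic p).mul (Z_monic q)).ne_zero
  have hq' : (1 : ℝ) ≤ q := by exact_mod_cast hq
  have hpq' : (q : ℝ) + 2 ≤ p := by exact_mod_cast hpq
  have hlt : 3 * Real.pi / (2 * (2 * p + 1)) < Real.pi / 2 := by
    rw [div_lt_div_iff₀ (by positivity) (by positivity)]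
    nlinarith
  have h3pos : 0 < 3 * Real.pi / (2 * (2 * (p : ℝ) + 1)) := by positivity
  have h13 : Real.pi / (2 * (2 * (p : ℝ) + 1)) < 3 * Real.pi / (2 * (2 * p + 1)) := by
    gcongr
    linarith
  have hle : Multiset.map (fun s => 4 * Real.sin s ^ 2) {Real.pi / (2 * (2 * (p : ℝ) + 1)),
      3 * Real.pi / (2 * (2 * (p : ℝ) + 1)), Real.pi / (2 * (2 * (q : ℝ) + 1))} ≤
        (Z p * Z q).roots := by
    rw [← Multiset.prod_X_sub_C_dvd_iff_le_roots hne]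
    simp only [Multiset.insert_eq_cons, Multiset.map_cons, Multiset.map_singleton,
      Multiset.prod_cons, Multiset.prod_singleton]
    rw [← mul_assoc]
    -- Only the two roots of `Z p` must be shown distinct; a coincidence with the root of `Z q` is
    -- absorbed by multiplicity.
    refine mul_dvd_mul (IsCoprime.mul_dvd ?_ (X_sub_C_dvd_Z (by omega)) ?_) (X_sub_C_dvd_Z hq)
    · refine isCoprime_X_sub_C_of_isUnit_sub (IsUnit.mk0 _ (sub_ne_zero.2 (ne_of_lt ?_)))
      have h1 : 0 < Real.sin (Real.pi / (2 * (2 * (p : ℝ) + 1))) :=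
        Real.sin_pos_of_pos_of_lt_pi (pi_div_odd_pos p) (by linarith)
      have h2 := Real.sin_lt_sin_of_lt_of_le_pi_div_two
        (by linarith [pi_div_odd_pos p]) hlt.le h13
      gcongr
    · exact dvd_iff_isRoot.2 (isRoot_Z (cos_pos_of_mem_Ioc ⟨h3pos, le_rfl⟩ hlt)
        (cos_second_root p))
  have heval : ∀ s : ℝ, (Z p * Z q).eval (4 * Real.sin s ^ 2) = (-1) ^ (p + q) →
      Real.cos s ^ 2 = Real.cos ((2 * p + 1) * s) * Real.cos ((2 * q + 1) * s) := by
    intro s h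
    have e : (Z p * Z q).eval (4 * Real.sin s ^ 2) * Real.cos s ^ 2 = (-1) ^ (p + q) *
        (Real.cos ((2 * p + 1) * s) * Real.cos ((2 * q + 1) * s)) := by
      rw [eval_mul, pow_add]
      linear_combination (Z q).eval (4 * Real.sin s ^ 2) * Real.cos s * eval_Z_mul_cos p s +
        (-1) ^ p * Real.cos ((2 * p + 1) * s) * eval_Z_mul_cos q s
    rw [h] at e
    exact mul_left_cancel₀ (pow_ne_zero _ (by norm_num)) e
  -- The threshold `p = 3q + 1` is where the second zero of `Z p` meets the first zero of `Z q`.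
  rcases le_total (p : ℝ) (3 * q + 1) with h | h
  · have hqle : Real.pi / (2 * (2 * (q : ℝ) + 1)) ≤ 3 * Real.pi / (2 * (2 * p + 1)) := by
      rw [div_le_div_iff₀ (by positivity) (by positivity)]
      nlinarith
    refine not_splits_sub_C_of_trig h3pos hlt hle ?_ (by simp) ?_
    · simp only [Multiset.insert_eq_cons, Multiset.mem_cons, Multiset.mem_singleton]
      rintro s (rfl | rfl | rfl)
      · exact ⟨pi_div_odd_pos _, h13.le⟩
      · exact ⟨h3pos, le_rfl⟩
      · exact ⟨pi_div_odd_pos _, hqle⟩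
    · intro s hs hs'
      have e := heval s hs'
      have hs2 := hs.2
      rw [le_div_iff₀ (by positivity)] at hs2
      have hs0 := hs.1
      -- Twice the product of these sines is `cos 2s - cos (2(p - q)s)`; its positivity forces `cos²
      -- s > cos ((2p + 1)s) cos ((2q + 1)s)`. The gap `p - q ≥ 2` is what makes the second sine
      -- positive.
      have hA : 0 < Real.sin (((p : ℝ) - q + 1) * s) :=
        Real.sin_pos_of_pos_of_lt_pi (mul_pos (by linarith) hs0) (by nlinarith)
      have hB : 0 < Real.sin (((p : ℝ) - q - 1) * s) :=
        Real.sin_pos_of_pos_of_lt_pi (mul_pos (by linarith) hs0) (by nlinarith)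
      have e1 : Real.cos ((2 * p + 1) * s) * Real.cos ((2 * q + 1) * s) =
          (Real.cos ((2 * p + 1) * s + (2 * q + 1) * s) +
            Real.cos ((p - q + 1) * s + (p - q - 1) * s)) / 2 := by
        rw [show ((p : ℝ) - q + 1) * s + (p - q - 1) * s = (2 * p + 1) * s - (2 * q + 1) * s by
          ring, Real.cos_add, Real.cos_sub]
        ring
      have e2 : Real.cos s ^ 2 =
          (1 + Real.cos (((p : ℝ) - q + 1) * s - (p - q - 1) * s)) / 2 := by
        rw [show ((p : ℝ) - q + 1) * s - (p - q - 1) * s = 2 * s by ring, Real.cos_sq]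
        ring
      rw [e1, e2, Real.cos_add (((p : ℝ) - q + 1) * s), Real.cos_sub] at e
      have h1 := Real.cos_le_one ((2 * p + 1) * s + (2 * q + 1) * s)
      have := mul_pos hA hB
      linarith
  · have hqle : 3 * Real.pi / (2 * (2 * p + 1)) ≤ Real.pi / (2 * (2 * (q : ℝ) + 1)) := by
      rw [div_le_div_iff₀ (by positivity) (by positivity)]
      nlinarith
    refine not_splits_sub_C_of_trig (pi_div_odd_pos q) (pi_div_odd_lt hq) hle ?_ (by simp) ?_
    · simp only [Multiset.insert_eq_cons, Multiset.mem_cons, Multiset.mem_singleton]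
      rintro s (rfl | rfl | rfl)
      · exact ⟨pi_div_odd_pos _, h13.le.trans hqle⟩
      · exact ⟨h3pos, hqle⟩
      · exact ⟨pi_div_odd_pos _, le_rfl⟩
    · intro s hs hs'
      have e := heval s hs'
      have hcos := cos_pos_of_mem_Ioc hs (pi_div_odd_lt hq)
      have h1 := Real.abs_cos_le_one ((2 * p + 1) * s)
      have h2 := cos_odd_mul_lt hq hs.1 (mul_odd_le_of_le hs.2)
      have h3 := mul_le_mul_of_nonneg_right h1 (abs_nonneg (Real.cos ((2 * q + 1) * s)))
      rw [← abs_mul, ← e, one_mul] at h3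
      have h4 : Real.cos s ^ 3 ≤ Real.cos s ^ 2 :=
        pow_le_pow_of_le_one hcos.le (Real.cos_le_one s) (by norm_num)
      have h5 := le_abs_self (Real.cos s ^ 2)
      linarith

end NonReal

/-! ### Equations in `Z` with only real solutions -/

section Real

theorem exists_four_mul_sin_sq_complex (μ : ℂ) : ∃ s, μ = 4 * Complex.sin s ^ 2 := by
  obtain ⟨w, hw⟩ := IsAlgClosed.exists_pow_nat_eq (μ / 4) two_pos
  obtain ⟨s, rfl⟩ := Complex.sin_surjective w
  exact ⟨s, by rw [hw]; ring⟩

theorem im_four_mul_sin_sq_eq_zero {s : ℂ} (hs : s.im = 0) :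
    (4 * Complex.sin s ^ 2).im = 0 := by
  obtain ⟨x, rfl⟩ : ∃ x : ℝ, s = x := ⟨s.re, Complex.ext rfl (by simp [hs])⟩
  have : (4 * Complex.sin x ^ 2 : ℂ) = ((4 * Real.sin x ^ 2 : ℝ) : ℂ) := by simp
  rw [this, Complex.ofReal_im]

theorem im_eq_zero_of_sin_natCast_mul {k : ℕ} (hk : k ≠ 0) {s : ℂ}
    (h : Complex.sin (k * s) = 0) : s.im = 0 := by
  obtain ⟨j, hj⟩ := Complex.sin_eq_zero_iff.1 h
  have := congrArg Complex.im hj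
  simpa [hk] using this

/-- The equation becomes `cos s = cos ((2n + 1)s)`, that is, `sin ((n + 1)s) sin (ns) = 0`. -/
theorem im_eq_zero_of_Z {n : ℕ} (hn : n ≠ 0) {μ : ℂ} (h : aeval μ (Z n) = (-1) ^ n) :
    μ.im = 0 := by
  obtain ⟨s, rfl⟩ := exists_four_mul_sin_sq_complex μ
  have e := aeval_Z_mul_cos n s
  rw [h] at e
  have e := mul_left_cancel₀ (pow_ne_zero n (by norm_num : (-1 : ℂ) ≠ 0)) e
  have h1 : Complex.sin ((n + 1 : ℕ) * s) * Complex.sin (n * s) = 0 := by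
    have e1 : s = ((n + 1 : ℕ) : ℂ) * s - n * s := by push_cast; ring
    have e2 : (2 * n + 1) * s = ((n + 1 : ℕ) : ℂ) * s + n * s := by push_cast; ring
    rw [e2, Complex.cos_add] at e
    conv_lhs at e => rw [e1, Complex.cos_sub]
    linear_combination e / 2
  apply im_four_mul_sin_sq_eq_zero
  rcases mul_eq_zero.1 h1 with h1 | h1
  · exact im_eq_zero_of_sin_natCast_mul (by omega) h1
  · exact im_eq_zero_of_sin_natCast_mul hn h1

/-- Here `cos² s = cos² ((2m + 1)s)`, and the difference of the two sides is `sin ((2m + 2)s) sin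
(2ms)`. -/
theorem im_eq_zero_of_Z_sq {m : ℕ} (hm : m ≠ 0) {μ : ℂ}
    (h : aeval μ (Z m) * aeval μ (Z m) = 1) : μ.im = 0 := by
  obtain ⟨s, rfl⟩ := exists_four_mul_sin_sq_complex μ
  have e := aeval_Z_mul_cos m s
  have e' : Complex.cos s ^ 2 = Complex.cos ((2 * m + 1) * s) ^ 2 := by
    have : ((-1 : ℂ) ^ m) ^ 2 = 1 := by rw [← pow_mul, mul_comm, pow_mul]; simp
    calc Complex.cos s ^ 2 = (aeval (4 * Complex.sin s ^ 2) (Z m) * Complex.cos s) ^ 2 := by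
          linear_combination -Complex.cos s ^ 2 * h
      _ = _ := by rw [e, mul_pow, this, one_mul]
  have h1 : Complex.sin ((2 * m + 2 : ℕ) * s) * Complex.sin ((2 * m : ℕ) * s) = 0 := by
    have e1 : ((2 * m + 2 : ℕ) : ℂ) * s = (2 * m + 1) * s + s := by push_cast; ring
    have e2 : ((2 * m : ℕ) : ℂ) * s = (2 * m + 1) * s - s := by push_cast; ring
    rw [e1, e2, Complex.sin_add, Complex.sin_sub]
    have a := Complex.sin_sq_add_cos_sq s
    have b := Complex.sin_sq_add_cos_sq ((2 * m + 1) * s)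
    linear_combination (Complex.cos s ^ 2) * b - Complex.cos ((2 * m + 1) * s) ^ 2 * a + e'
  apply im_four_mul_sin_sq_eq_zero
  rcases mul_eq_zero.1 h1 with h1 | h1
  · exact im_eq_zero_of_sin_natCast_mul (by omega) h1
  · exact im_eq_zero_of_sin_natCast_mul (by omega) h1

/-- With `θ = (2m + 2)s`, the equation is `cos² s = cos (θ + s) cos (θ - s) = cos² s - sin² θ`. -/
theorem im_eq_zero_of_Z_mul_Z_succ {m : ℕ} {μ : ℂ}
    (h : aeval μ (Z (m + 1)) * aeval μ (Z m) = -1) : μ.im = 0 := by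
  obtain ⟨s, rfl⟩ := exists_four_mul_sin_sq_complex μ
  have e := aeval_Z_mul_cos m s
  have e₁ := aeval_Z_mul_cos (m + 1) s
  have hsq : (-1 : ℂ) ^ m * (-1) ^ m = 1 := by rw [← mul_pow]; simp
  have e' : Complex.cos s ^ 2 =
      Complex.cos ((2 * (m + 1 : ℕ) + 1) * s) * Complex.cos ((2 * m + 1) * s) := by
    linear_combination Complex.cos s ^ 2 * h -
      aeval (4 * Complex.sin s ^ 2) (Z m) * Complex.cos s * e₁ -
      (-1) ^ (m + 1) * Complex.cos ((2 * (m + 1 : ℕ) + 1) * s) * e +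
      Complex.cos ((2 * (m + 1 : ℕ) + 1) * s) * Complex.cos ((2 * m + 1) * s) * hsq
  have h1 : Complex.sin ((2 * m + 2 : ℕ) * s) ^ 2 = 0 := by
    have e1 : (2 * ((m + 1 : ℕ) : ℂ) + 1) * s = (2 * m + 2 : ℕ) * s + s := by push_cast; ring
    have e2 : (2 * (m : ℂ) + 1) * s = (2 * m + 2 : ℕ) * s - s := by push_cast; ring
    rw [e1, e2, Complex.cos_add, Complex.cos_sub] at e'
    have a := Complex.sin_sq_add_cos_sq s
    have b := Complex.sin_sq_add_cos_sq ((2 * m + 2 : ℕ) * s)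
    linear_combination e' + (Complex.cos s ^ 2) * b - Complex.sin ((2 * m + 2 : ℕ) * s) ^ 2 * a
  exact im_four_mul_sin_sq_eq_zero (im_eq_zero_of_sin_natCast_mul (by omega) (pow_eq_zero_iff
    (by norm_num) |>.1 h1))

end Real

theorem Isomorphic.trans {U V W : Type*} {Γ : Digraph V} {Δ : Digraph W} {Θ : Digraph U}
    (h : Isomorphic Γ Δ) (h' : Isomorphic Δ Θ) : Isomorphic Γ Θ :=
  ⟨h.some.trans h'.some⟩

/-! ### Essential cyclicity as failure to split over the reals -/

section EssentiallyCyclic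

variable {V W : Type*} [Fintype V] [DecidableEq V] [Fintype W] [DecidableEq W]

theorem not_essentiallyCyclic_iff {Γ : Digraph V} :
    ¬ EssentiallyCyclic Γ ↔ ∀ μ : ℂ, aeval μ (laplacian Γ).charpoly = 0 → μ.im = 0 := by
  unfold EssentiallyCyclic
  push Not
  refine forall_congr' fun μ => ?_
  rw [Matrix.mem_spectrum_iff_isRoot_charpoly, Matrix.charpoly_map, IsRoot, eval_map_algebraMap]

theorem essentiallyCyclic_iff_not_splits {Γ : Digraph V} :
    EssentiallyCyclic Γ ↔ ¬ (laplacian Γ).charpoly.Splits := by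
  rw [← not_iff_not, not_not, not_essentiallyCyclic_iff]
  have hne := (Matrix.charpoly_monic (laplacian Γ)).ne_zero
  constructor
  · intro h
    refine Splits.of_splits_map (algebraMap ℝ ℂ) (IsAlgClosed.splits _) fun μ hμ => ?_
    refine ⟨μ.re, Complex.ext rfl ?_⟩
    rw [mem_roots (map_ne_zero hne), IsRoot, eval_map_algebraMap] at hμ
    simpa using (h μ hμ).symm
  · intro h μ hμ
    rw [← eval_map_algebraMap] at hμ
    obtain ⟨x, rfl⟩ := h.mem_range_of_isRoot hne hμ
    simp

theorem Isomorphic.charpoly_eq {Γ : Digraph V} {Δ : Digraph W} (h : Isomorphic Γ Δ) :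
    (laplacian Γ).charpoly = (laplacian Δ).charpoly := by
  obtain ⟨e⟩ := h
  rw [← Matrix.charpoly_reindex e.toEquiv]
  congr 1
  ext v w
  obtain ⟨v, rfl⟩ := e.surjective v
  obtain ⟨w, rfl⟩ := e.surjective w
  have h1 : ∀ v, e.toEquiv.symm (e v) = v := fun v => e.toEquiv.symm_apply_apply v
  rw [Matrix.reindex_apply, Matrix.submatrix_apply, h1, h1]
  rcases eq_or_ne v w with rfl | hvw
  · simp only [laplacian, Matrix.of_apply, if_true]
    congr 1
    refine Finset.sum_equiv e.toEquiv (fun k => ?_) fun k _ => ?_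
    · rw [Finset.mem_erase, Finset.mem_erase]
      exact and_congr e.injective.ne_iff.symm (by simp)
    · have hk : Δ.Adj (e v) (e.toEquiv k) ↔ Γ.Adj v k := e.map_rel_iff
      by_cases h : Γ.Adj v k
      · rw [if_pos h, if_pos (hk.2 h)]
      · rw [if_neg h, if_neg (mt hk.1 h)]
  · have hvw' : e v ≠ e w := e.injective.ne hvw
    by_cases h : Γ.Adj v w
    · rw [laplacian_of_adj hvw h, laplacian_of_adj hvw' (e.map_rel_iff.2 h)]
    · rw [laplacian_of_not_adj hvw h, laplacian_of_not_adj hvw' (mt e.map_rel_iff.1 h)]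

theorem Isomorphic.essentiallyCyclic_iff {Γ : Digraph V} {Δ : Digraph W} (h : Isomorphic Γ Δ) :
    EssentiallyCyclic Γ ↔ EssentiallyCyclic Δ := by
  rw [essentiallyCyclic_iff_not_splits, essentiallyCyclic_iff_not_splits, h.charpoly_eq]

theorem not_essentiallyCyclic_of_symm {Γ : Digraph V} (h : ∀ v w, Γ.Adj v w ↔ Γ.Adj w v) :
    ¬ EssentiallyCyclic Γ := by
  rw [essentiallyCyclic_iff_not_splits, not_not]
  have hH : (laplacian Γ).IsHermitian := by
    ext v w
    rw [Matrix.conjTranspose_apply, star_trivial]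
    rcases eq_or_ne v w with rfl | hvw
    · rfl
    · by_cases hA : Γ.Adj v w
      · rw [laplacian_of_adj hvw hA, laplacian_of_adj hvw.symm ((h v w).1 hA)]
      · rw [laplacian_of_not_adj hvw hA, laplacian_of_not_adj hvw.symm (mt (h v w).2 hA)]
  exact hH.splits_charpoly

end EssentiallyCyclic

/-! ### Classification by the number of missing arcs -/

section Classification

variable {n : ℕ} {Γ : Digraph (ZMod n)}

theorem isRing_of_adj_iff {A : ZMod n → Prop}
    (h : ∀ v w, Γ.Adj v w ↔ w = v - 1 ∨ (w = v + 1 ∧ A v)) : IsRing Γ :=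
  ⟨fun {v w} hvw => (h v w).2 (Or.inl hvw),
    fun {v w} hvw => ((h v w).1 hvw).imp (fun h => h) And.left⟩

theorem indegree_eq_one_iff_of_adj_iff (hn : 3 ≤ n) {A : ZMod n → Prop}
    (h : ∀ v w, Γ.Adj v w ↔ w = v - 1 ∨ (w = v + 1 ∧ A v)) (v : ZMod n) :
    indegree Γ v = 1 ↔ ¬ A (v - 1) := by
  rw [(isRing_of_adj_iff h).indegree_eq_one_iff hn, h]
  have h1 : v ≠ v - 1 - 1 := fun h => two_ne_zero_zmod hn (by linear_combination h)
  simp [h1]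

theorem ringMinusOne_adj (v w : ZMod n) :
    (ringMinusOne n).Adj v w ↔ w = v - 1 ∨ (w = v + 1 ∧ v ≠ 0) := Iff.rfl

theorem ringMinusTwo_adj (i : ℕ) (v w : ZMod n) :
    (ringMinusTwo n i).Adj v w ↔ w = v - 1 ∨ (w = v + 1 ∧ (v ≠ 0 ∧ v ≠ (i : ZMod n))) := Iff.rfl

theorem fullRing_adj (v w : ZMod n) :
    (fullRing n).Adj v w ↔ w = v - 1 ∨ w = v + 1 := Iff.rfl

theorem IsRing.adj_iff_indegree (hn : 3 ≤ n) (hΓ : IsRing Γ) (v w : ZMod n) :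
    Γ.Adj v w ↔ w = v - 1 ∨ (w = v + 1 ∧ ¬ indegree Γ (v + 1) = 1) := by
  rw [hΓ.adj_iff, hΓ.indegree_eq_one_iff hn, add_sub_cancel_right, not_not]

theorem isomorphic_of_rotation {Δ : Digraph (ZMod n)} {A B : ZMod n → Prop}
    (hΓ : ∀ v w, Γ.Adj v w ↔ w = v - 1 ∨ (w = v + 1 ∧ A v))
    (hΔ : ∀ v w, Δ.Adj v w ↔ w = v - 1 ∨ (w = v + 1 ∧ B v)) (t : ZMod n)
    (h : ∀ v, A v ↔ B (v + t)) : Isomorphic Γ Δ := by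
  refine ⟨⟨Equiv.addRight t, fun {v w} => ?_⟩⟩
  rw [hΔ, hΓ, h]
  simp only [Equiv.coe_addRight]
  have e1 : w + t = v + t - 1 ↔ w = v - 1 := by
    rw [add_sub_right_comm, add_left_inj]
  have e2 : w + t = v + t + 1 ↔ w = v + 1 := by
    rw [add_right_comm, add_left_inj]
  rw [e1, e2]

variable [NeZero n]

theorem essentiallyCyclic_of_three_le (hn : 3 ≤ n) (hΓ : IsRing Γ)
    (h : 3 ≤ ({v : ZMod n | indegree Γ v = 1} : Finset (ZMod n)).card) : EssentiallyCyclic Γ := by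
  obtain ⟨r, hr⟩ := Finset.card_pos.1 (by omega :
    0 < ({v : ZMod n | indegree Γ v = 1} : Finset (ZMod n)).card)
  rw [essentiallyCyclic_iff_not_splits, hΓ.charpoly_laplacian hn (Finset.mem_filter.1 hr).2,
    show ((-1) ^ n : ℝ[X]) = C ((-1) ^ n) by simp]
  exact not_splits_prod_Z_sub_C _ _
    (fun v hv => (pathLength_spec (Finset.mem_filter.1 hv).2).1) h (by simp)

theorem IsRing.charpoly_eq_of_singleton (hn : 3 ≤ n) (hΓ : IsRing Γ) {u : ZMod n}
    (h : ∀ v, indegree Γ v = 1 ↔ v = u) :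
    (laplacian Γ).charpoly = Z n - C ((-1) ^ n) := by
  have hu := (h u).2 rfl
  have hS : ({v : ZMod n | indegree Γ v = 1} : Finset (ZMod n)) = {u} := by
    ext v; simp [h]
  have h1 := hΓ.charpoly_laplacian hn hu
  have h2 := hΓ.sum_pathLength hn hu
  rw [hS, Finset.prod_singleton] at h1
  rw [hS, Finset.sum_singleton] at h2
  rw [h1, h2]
  simp

theorem IsRing.charpoly_eq_of_pair (hn : 3 ≤ n) (hΓ : IsRing Γ) {u w : ZMod n} (huw : u ≠ w)
    (h : ∀ v, indegree Γ v = 1 ↔ v = u ∨ v = w) :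
    ∃ p q : ℕ, 1 ≤ p ∧ 1 ≤ q ∧ p + q = n ∧ w = u - (p : ZMod n) ∧ u = w - (q : ZMod n) ∧
      (laplacian Γ).charpoly = Z p * Z q - C ((-1) ^ (p + q)) := by
  have hu := (h u).2 (Or.inl rfl)
  have hw := (h w).2 (Or.inr rfl)
  have hS : ({v : ZMod n | indegree Γ v = 1} : Finset (ZMod n)) = {u, w} := by
    ext v; simp [h]
  have h1 := hΓ.charpoly_laplacian hn hu
  have h2 := hΓ.sum_pathLength hn hu
  rw [hS, Finset.prod_pair huw] at h1
  rw [hS, Finset.sum_pair huw] at h2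
  obtain ⟨hp, hp'⟩ := pathLength_spec hu
  obtain ⟨hq, hq'⟩ := pathLength_spec hw
  -- Both path lengths are positive with sum `n`, so neither path closes up on its own start: each
  -- leads to the other vertex.
  have key : ∀ v : ZMod n, ∀ k : ℕ, 0 < k → k < n → v - (k : ZMod n) ≠ v := by
    intro v k hk hkn h
    have : (k : ZMod n) = 0 := by linear_combination -h
    rw [ZMod.natCast_eq_zero_iff] at this
    exact absurd (Nat.le_of_dvd hk this) (by omega)
  refine ⟨pathLength Γ u, pathLength Γ w, hp, hq, h2, ?_, ?_, ?_⟩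
  · exact (((h _).1 hp').resolve_left (key u _ hp (by omega))).symm
  · exact (((h _).1 hq').resolve_right (key w _ hq (by omega))).symm
  · rw [h1, h2]; simp

theorem not_essentiallyCyclic_fullRing : ¬ EssentiallyCyclic (fullRing n) := by
  refine not_essentiallyCyclic_of_symm fun v w => ?_
  rw [fullRing_adj, fullRing_adj]
  constructor <;> rintro (rfl | rfl) <;> simp

theorem not_essentiallyCyclic_ringMinusOne (hn : 3 ≤ n) :
    ¬ EssentiallyCyclic (ringMinusOne n) := by
  have hS : ∀ v, indegree (ringMinusOne n) v = 1 ↔ v = 1 := fun v => by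
    rw [indegree_eq_one_iff_of_adj_iff hn ringMinusOne_adj, not_not, sub_eq_zero]
  rw [not_essentiallyCyclic_iff,
    (isRing_of_adj_iff ringMinusOne_adj).charpoly_eq_of_singleton hn hS]
  intro μ hμ
  rw [map_sub, sub_eq_zero] at hμ
  exact im_eq_zero_of_Z (by omega) (hμ.trans (by simp))

theorem not_essentiallyCyclic_ringMinusTwo (hn : 3 ≤ n) :
    ¬ EssentiallyCyclic (ringMinusTwo n (n / 2)) := by
  have hS : ∀ v, indegree (ringMinusTwo n (n / 2)) v = 1 ↔
      v = ((n / 2 : ℕ) : ZMod n) + 1 ∨ v = 1 := fun v => by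
    rw [indegree_eq_one_iff_of_adj_iff hn (ringMinusTwo_adj _), ← not_or, not_not, sub_eq_zero,
      sub_eq_iff_eq_add, or_comm]
  have hne : ((n / 2 : ℕ) : ZMod n) + 1 ≠ 1 := by
    rw [Ne, add_eq_right, ZMod.natCast_eq_zero_iff]
    exact fun h => absurd (Nat.le_of_dvd (by omega) h) (by omega)
  obtain ⟨p, q, hp, hq, hpq, h1, -, hchar⟩ :=
    (isRing_of_adj_iff (ringMinusTwo_adj (n / 2))).charpoly_eq_of_pair hn hne hS
  have hp2 : p = n / 2 := by
    have : (p : ZMod n) = ((n / 2 : ℕ) : ZMod n) := by linear_combination h1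
    rwa [ZMod.natCast_eq_natCast_iff', Nat.mod_eq_of_lt (by omega),
      Nat.mod_eq_of_lt (by omega)] at this
  rw [not_essentiallyCyclic_iff, hchar]
  intro μ hμ
  rw [map_sub, map_mul, sub_eq_zero] at hμ
  -- The path lengths are `n / 2` and `n - n / 2`, so the parity of `n` decides.
  rcases (by omega : q = p ∨ q = p + 1) with rfl | rfl
  · exact im_eq_zero_of_Z_sq (by omega) (hμ.trans (by simp [← two_mul]))
  · rw [mul_comm] at hμ
    exact im_eq_zero_of_Z_mul_Z_succ (hμ.trans (by simp [← add_assoc, ← two_mul, pow_succ]))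

theorem isomorphic_of_not_essentiallyCyclic (hn : 3 ≤ n) (hΓ : IsRing Γ)
    (h : ¬ EssentiallyCyclic Γ) :
    Isomorphic Γ (fullRing n) ∨ Isomorphic Γ (ringMinusOne n) ∨
      Isomorphic Γ (ringMinusTwo n (n / 2)) := by
  have hadj := hΓ.adj_iff_indegree hn
  have hcard : ({v : ZMod n | indegree Γ v = 1} : Finset (ZMod n)).card < 3 := by
    by_contra h'
    exact h (essentiallyCyclic_of_three_le hn hΓ (not_lt.1 h'))
  interval_cases hc : ({v : ZMod n | indegree Γ v = 1} : Finset (ZMod n)).card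
  · have hS : ∀ v, ¬ indegree Γ v = 1 := by
      simpa [Finset.card_eq_zero, Finset.filter_eq_empty_iff] using hc
    refine Or.inl (isomorphic_of_rotation (B := fun _ => True) hadj
      (fun v w => by simp [fullRing_adj]) 0 fun v => ?_)
    simp [hS]
  · obtain ⟨u, hu⟩ := Finset.card_eq_one.1 hc
    have hS : ∀ v, indegree Γ v = 1 ↔ v = u := fun v => by
      simpa using Finset.ext_iff.1 hu v
    refine Or.inr (Or.inl (isomorphic_of_rotation hadj ringMinusOne_adj (1 - u) fun v => ?_))
    rw [hS, not_iff_not, ← sub_eq_zero, add_sub_assoc]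
  · obtain ⟨u, w, huw, hu⟩ := Finset.card_eq_two.1 hc
    have hS : ∀ v, indegree Γ v = 1 ↔ v = u ∨ v = w := fun v => by
      simpa using Finset.ext_iff.1 hu v
    -- The pair is unordered, so the rotation is set up for whichever vertex starts a path of length
    -- `n / 2`.
    have key : ∀ u w : ZMod n, (∀ v, indegree Γ v = 1 ↔ v = u ∨ v = w) →
        w = u - ((n / 2 : ℕ) : ZMod n) → Isomorphic Γ (ringMinusTwo n (n / 2)) := by
      intro u w hS hw
      refine isomorphic_of_rotation hadj (ringMinusTwo_adj _)
        (((n / 2 : ℕ) : ZMod n) + 1 - u) fun v => ?_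
      rw [hS, hw, ← not_or, not_iff_not, or_comm]
      refine or_congr ⟨fun h => ?_, fun h => ?_⟩ ⟨fun h => ?_, fun h => ?_⟩ <;>
        linear_combination h
    obtain ⟨p, q, hp, hq, hpq, h1, h2, hchar⟩ := hΓ.charpoly_eq_of_pair hn huw hS
    rw [essentiallyCyclic_iff_not_splits, hchar, not_not] at h
    have hpq1 : p < q + 2 := by
      by_contra h'
      exact not_splits_Z_mul_Z_sub_C hq (not_lt.1 h') h
    have hpq2 : q < p + 2 := by
      by_contra h'
      rw [mul_comm, add_comm p q] at h
      exact not_splits_Z_mul_Z_sub_C hp (not_lt.1 h') h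
    refine Or.inr (Or.inr ?_)
    rcases (by omega : p = n / 2 ∨ q = n / 2) with hpn | hqn
    · exact key u w hS (hpn ▸ h1)
    · exact key w u (fun v => (hS v).trans or_comm) (hqn ▸ h2)

end Classification

end RingDigraph

theorem theorem4 (n : ℕ) [NeZero n] :
    (3 < n → ∀ Γ : Digraph (ZMod n), RingDigraph.IsRing Γ →
      2 < (RingDigraph.missingArcs Γ).ncard → (RingDigraph.missingArcs Γ).ncard < n →
        (RingDigraph.laplacian Γ).charpoly =
            (∏ v : ZMod n with RingDigraph.indegree Γ v = 1,
              RingDigraph.Z (RingDigraph.pathLength Γ v)) - (-1) ^ n ∧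
          RingDigraph.EssentiallyCyclic Γ) ∧
    (3 ≤ n → ∀ Γ : Digraph (ZMod n), RingDigraph.HasRingStructure Γ →
      (RingDigraph.EssentiallyCyclic Γ ↔
        ¬ (RingDigraph.Isomorphic Γ (RingDigraph.fullRing n) ∨
          RingDigraph.Isomorphic Γ (RingDigraph.ringMinusOne n) ∨
          RingDigraph.Isomorphic Γ (RingDigraph.ringMinusTwo n (n / 2))))) := by
  refine ⟨fun hn Γ hΓ h2 _ => ?_, fun hn Γ ⟨Δ, hΔ, hiso⟩ => ⟨fun h => ?_, fun h => ?_⟩⟩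
  · rw [RingDigraph.ncard_missingArcs hn.le hΓ] at h2
    obtain ⟨r, hr⟩ := Finset.card_pos.1 (two_pos.trans h2)
    exact ⟨hΓ.charpoly_laplacian hn.le (Finset.mem_filter.1 hr).2,
      RingDigraph.essentiallyCyclic_of_three_le hn.le hΓ h2⟩
  · rintro (h' | h' | h')
    · exact RingDigraph.not_essentiallyCyclic_fullRing (h'.essentiallyCyclic_iff.1 h)
    · exact RingDigraph.not_essentiallyCyclic_ringMinusOne hn (h'.essentiallyCyclic_iff.1 h)
    · exact RingDigraph.not_essentiallyCyclic_ringMinusTwo hn (h'.essentiallyCyclic_iff.1 h)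
  · by_contra h'
    rw [hiso.essentiallyCyclic_iff] at h'
    exact h ((RingDigraph.isomorphic_of_not_essentiallyCyclic hn hΔ h').imp hiso.trans
      (Or.imp hiso.trans hiso.trans))
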